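/- Let $j=\sqrt{-1}$, let $A,E\in\mathbb R^{n\times n}$, and let $\alpha,\beta\in\mathbb C$ be such that $W:=\alpha E+\beta A$ is invertible (so the pencil $(A,E)$ is regular). Let $\theta_1\in(-\pi,\pi)$, and assume that $e^{j\phi}$ is not an eigenvalue of $(A,E)$, i.e. $\det(A-e^{j\phi}E)\neq0$, for every $\phi\in\mathbb R$ whose wrapped value $\arg(e^{j\phi})\in(-\pi,\pi]$ lies in $[\theta_1,\pi]$. Put $t_1:=\tan(\theta_1/2)$ and $\eta_f:=\log(t_1-j)$ and, for $\varepsilon\in\mathbb C$, $$A_\varepsilon:=A+\alpha\varepsilon I,\quad E_\varepsilon:=E-\beta\varepsilon I,\quad \Phi_+(\varepsilon):=E_\varepsilon+A_\varepsilon,\quad \Phi_-(\varepsilon):=E_\varepsilon-A_\varepsilon,$$ $$Y_\varepsilon:=-\eta_f I+\log\big(t_1I-j\,\Phi_-(\varepsilon)\Phi_+(\varepsilon)^{-1}\big),\qquad Y:=-\eta_f I+\log\big(t_1I-j\,\Phi_-(0)\Phi_+(0)^{-1}\big),$$ where $\log$ of a matrix $X$ is its principal logarithm, the unique $Q$ with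 $e^Q=X$ all of whose eigenvalues satisfy $-\pi<\operatorname{Im}\lambda<\pi$. Let $\psi_1(X):=\sum_{k=0}^\infty \frac{1}{(k+1)!}X^k$. Then $\Phi_+(\varepsilon)^{-1}$ and the logarithm in $Y_\varepsilon$ exist for all sufficiently small $\varepsilon$ (including $\varepsilon=0$), $e^{Y_\varepsilon}-I$ is invertible for all sufficiently small $\varepsilon\ne0$, $\psi_1(Y)$ is invertible, $$\lim_{\varepsilon\to0}Y_\varepsilon=Y,\qquad L_f:=\lim_{\varepsilon\to0}(e^{Y_\varepsilon}-I)^{-1}Y_\varepsilon=\psi_1(Y)^{-1},$$ and the (entrywise convergent) integral is $$\int_{\theta_1}^{\pi}(e^{j\theta}E-A)^{-1}\,d\theta=\frac1j\,W^{-1}L_f\Big(e^{Y}(\alpha-\beta)+(e^{-j\theta_1}\alpha+\beta)I\Big).$$ -/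

import Mathlib

open Matrix Filter Topology

noncomputable section

namespace FreqTrunc

/-- `wrap φ` is the principal argument, in `(-π, π]`, of `exp (jφ)`. -/
def wrap (φ : ℝ) : ℝ := (Complex.exp (φ * Complex.I)).arg

/-- A real matrix regarded as a complex matrix. -/
def toC {n : ℕ} (A : Matrix (Fin n) (Fin n) ℝ) : Matrix (Fin n) (Fin n) ℂ :=
  A.map Complex.ofReal

/-- `μ` is an eigenvalue of the matrix pencil `(A, E)`: `det (A - μ E) = 0`. -/
def IsPencilEigenvalue {n : ℕ} (A E : Matrix (Fin n) (Fin n) ℂ) (μ : ℂ) : Prop :=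
  (A - μ • E).det = 0

/-- The descriptor transfer function `K(z) = (zE - A)⁻¹`. -/
def transfer {n : ℕ} (A E : Matrix (Fin n) (Fin n) ℂ) (z : ℂ) : Matrix (Fin n) (Fin n) ℂ :=
  (z • E - A)⁻¹

/-- The entrywise integral of a matrix-valued function over the interval from `a` to `b`. -/
def matrixIntegral {n : ℕ} (F : ℝ → Matrix (Fin n) (Fin n) ℂ) (a b : ℝ) :
    Matrix (Fin n) (Fin n) ℂ :=
  Matrix.of fun i k => ∫ θ in a..b, F θ i k

/-- `Q` is a principal logarithm of `X`: `exp Q = X`, and every eigenvalue of `Q` lies in the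
open strip `-π < im z < π`. -/
def IsPrincipalLog {n : ℕ} (X Q : Matrix (Fin n) (Fin n) ℂ) : Prop :=
  NormedSpace.exp Q = X ∧ ∀ μ ∈ spectrum ℂ Q, -Real.pi < μ.im ∧ μ.im < Real.pi

open Classical in
/-- The principal logarithm of a complex matrix: the unique `Q` with `IsPrincipalLog X Q`, and `0`
where there is none. -/
def principalLog {n : ℕ} (X : Matrix (Fin n) (Fin n) ℂ) : Matrix (Fin n) (Fin n) ℂ :=
  if h : ∃! Q, IsPrincipalLog X Q then h.choose else 0

/-- `ψ₁(X) = ∑ X ^ j / (j + 1)!`. -/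
def psi1 {n : ℕ} (X : Matrix (Fin n) (Fin n) ℂ) : Matrix (Fin n) (Fin n) ℂ :=
  ∑' j : ℕ, ((Nat.factorial (j + 1) : ℂ)⁻¹) • X ^ j

/-- `A_ε = A + α ε I`. -/
def Aeps {n : ℕ} (A : Matrix (Fin n) (Fin n) ℂ) (α ε : ℂ) : Matrix (Fin n) (Fin n) ℂ :=
  A + (α * ε) • 1

/-- `E_ε = E - β ε I`. -/
def Eeps {n : ℕ} (E : Matrix (Fin n) (Fin n) ℂ) (β ε : ℂ) : Matrix (Fin n) (Fin n) ℂ :=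
  E - (β * ε) • 1

/-- `Φ₊(ε) = E_ε + A_ε`. -/
def phiPlus {n : ℕ} (A E : Matrix (Fin n) (Fin n) ℂ) (α β ε : ℂ) : Matrix (Fin n) (Fin n) ℂ :=
  Eeps E β ε + Aeps A α ε

/-- `Φ₋(ε) = E_ε - A_ε`. -/
def phiMinus {n : ℕ} (A E : Matrix (Fin n) (Fin n) ℂ) (α β ε : ℂ) : Matrix (Fin n) (Fin n) ℂ :=
  Eeps E β ε - Aeps A α ε

/-- `η_f = log (t₁ - j)` with `t₁ = tan (θ₁ / 2)`. -/
def etaF (θ₁ : ℝ) : ℂ := Complex.log ((Real.tan (θ₁ / 2) : ℂ) - Complex.I)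

/-- `t₁ I - j Φ₋(ε) Φ₊(ε)⁻¹` with `t₁ = tan (θ₁ / 2)`. -/
def logArg {n : ℕ} (A E : Matrix (Fin n) (Fin n) ℂ) (α β : ℂ) (θ₁ : ℝ) (ε : ℂ) :
    Matrix (Fin n) (Fin n) ℂ :=
  (Real.tan (θ₁ / 2) : ℂ) • 1 - Complex.I • (phiMinus A E α β ε * (phiPlus A E α β ε)⁻¹)

/-- `Y_ε = -η_f I + log (t₁ I - j Φ₋(ε) Φ₊(ε)⁻¹)`. -/
def Yeps {n : ℕ} (A E : Matrix (Fin n) (Fin n) ℂ) (α β : ℂ) (θ₁ : ℝ) (ε : ℂ) :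
    Matrix (Fin n) (Fin n) ℂ :=
  -(etaF θ₁ • 1) + principalLog (logArg A E α β θ₁ ε)

end FreqTrunc

end

/-! Put `R = (E - A)(E + A)⁻¹` and `T(θ) = sin(θ/2) I - j cos(θ/2) R`. Up to a nonzero scalar,
`T(θ)` is `(e^{jθ}E - A)(E + A)⁻¹`, so it is invertible on `[θ₁, π]`. Moreover `T(π) = I`, and `T'
T⁻¹ = (j/2) I + j A K(e^{jθ})` with `K(z) = (zE - A)⁻¹`. Integrating this commuting logarithmic
derivative gives a logarithm of `T(θ₁)`. It is the principal one, since on each eigenvector of `R`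
the path is a scalar curve from `1` that avoids the closed negative axis (`isPrincipalLog_arcPath`).
Since `t₁ I - jR = T(θ₁)/cos(θ₁/2)`, subtracting `η_f` removes the scalar part and leaves `Y = -j A
∫ K` (`RegularOnArc.cayleyLog_eq`).

If `A` is invertible, this determines the integral. There `e^Y` and `W A⁻¹` are functions of `E
A⁻¹`, the last factor of the formula equals `-(e^Y - I) W A⁻¹`, and `e^Y - I = Y ψ₁(Y)`; hence the
right-hand side collapses to `-(1/j) A⁻¹ Y` (`RegularOnArc.arcIntegral_eq_of_isUnit`).

For singular `A` the perturbation makes `A_ε` invertible for small `ε ≠ 0` and leaves `W` unchanged.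
Regularity on the compact arc is an open condition, and both sides of the formula converge as `ε →
0`. Invertibility of `ψ₁(Y)` holds because the eigenvalues of `Y` have imaginary part below `2π` in
modulus, so none is a nonzero multiple of `2πj`. -/

namespace FreqTrunc

/-! ### Calculus in Banach algebras: commuting families and parametric integrals. -/

/-- The derivative of `exp ∘ L` for a path `L` of commuting elements of a Banach algebra. -/
theorem hasDerivAt_exp_of_commute {𝔸 : Type*} [NormedRing 𝔸] [NormedAlgebra ℝ 𝔸]
    [CompleteSpace 𝔸] {L : ℝ → 𝔸} {L' : 𝔸} {x : ℝ} (hL : HasDerivAt L L' x)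
    (hc : ∀ y, Commute (L x) (L y)) :
    HasDerivAt (fun y => NormedSpace.exp (L y)) (NormedSpace.exp (L x) * L') x := by
  let _ : NormedAlgebra ℚ 𝔸 := NormedAlgebra.restrictScalars ℚ ℝ 𝔸
  have h1 : HasDerivAt (fun y => L y - L x) L' x := hL.sub_const _
  have h0 : HasFDerivAt (NormedSpace.exp : 𝔸 → 𝔸) (1 : 𝔸 →L[ℝ] 𝔸) (L x - L x) := by
    rw [sub_self]; exact hasFDerivAt_exp_zero
  have h2 := (h0.comp_hasDerivAt x h1).const_mul (NormedSpace.exp (L x))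
  -- Splitting off `exp (L x)` leaves only the derivative of `exp` at `0`, which is the identity.
  have h3 : (fun y => NormedSpace.exp (L y)) =
      fun y => NormedSpace.exp (L x) * (NormedSpace.exp ∘ fun y => L y - L x) y := by
    funext y
    rw [Function.comp_apply, ← NormedSpace.exp_add_of_commute ((hc y).sub_right (Commute.refl _))]
    congr 1; abel
  rw [h3]; exact h2

/-- Left and right multiplication by `z` are continuous linear maps, so both pass through the
integral; a non-integrable `G` has integral `0`. -/
theorem commute_intervalIntegral {𝔸 : Type*} [NormedRing 𝔸] [NormedAlgebra ℝ 𝔸]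
    [CompleteSpace 𝔸] {G : ℝ → 𝔸} {z : 𝔸} {a b : ℝ} (h : ∀ x, Commute z (G x)) :
    Commute z (∫ x in a..b, G x) := by
  by_cases hG : IntervalIntegrable G MeasureTheory.volume a b
  · have h1 := ((ContinuousLinearMap.mul ℝ 𝔸) z).intervalIntegral_comp_comm hG
    have h2 := ((ContinuousLinearMap.mul ℝ 𝔸).flip z).intervalIntegral_comp_comm hG
    simp only [ContinuousLinearMap.mul_apply', ContinuousLinearMap.flip_apply] at h1 h2
    rw [commute_iff_eq, ← h1, ← h2]
    exact congrArg (fun f => ∫ x in a..b, f x) (funext fun x => (h x).eq)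
  · rw [intervalIntegral.integral_undef hG]; exact Commute.zero_right _

/-- If `T' = G T` on `[a, b]` for a commuting family `G`, then
`T b = exp (∫ G) T a`. -/
theorem exp_neg_integral_mul_eq {𝔸 : Type*} [NormedRing 𝔸] [NormedAlgebra ℝ 𝔸]
    [CompleteSpace 𝔸] {T G : ℝ → 𝔸} {a b : ℝ} (hab : a ≤ b) {s : Set ℝ} (hs : IsOpen s)
    (hsub : Set.Icc a b ⊆ s) (hG : ContinuousOn G s)
    (hT : ∀ x ∈ s, HasDerivAt T (G x * T x) x) (hc : ∀ x y, Commute (G x) (G y)) :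
    NormedSpace.exp (-∫ x in a..b, G x) * T b = T a := by
  have hint : ∀ x ∈ Set.Icc a b, IntervalIntegrable G MeasureTheory.volume a x := fun x hx =>
    (hG.mono ((Set.uIcc_subset_Icc (Set.left_mem_Icc.2 hab) hx).trans hsub)).intervalIntegrable
  set L : ℝ → 𝔸 := fun x => -∫ y in a..x, G y with hL
  have hcL : ∀ z y, Commute (L z) (L y) := fun z y =>
    (commute_intervalIntegral fun x => ((commute_intervalIntegral fun w =>
      hc x w).neg_right).symm).neg_right
  have hLd : ∀ x ∈ Set.Icc a b, HasDerivAt L (-G x) x := fun x hx =>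
    (intervalIntegral.integral_hasDerivAt_right (hint x hx)
      (hG.stronglyMeasurableAtFilter hs x (hsub hx))
      (hG.continuousAt (hs.mem_nhds (hsub hx)))).neg
  -- Integrating factor: the two terms of the product rule cancel, so `exp (L) T` is constant.
  have hD : ∀ x ∈ Set.Icc a b, HasDerivAt (fun x => NormedSpace.exp (L x) * T x) 0 x := by
    intro x hx
    have h := (hasDerivAt_exp_of_commute (hLd x hx) (hcL x)).mul (hT x (hsub hx))
    refine h.congr_deriv ?_
    rw [mul_neg, neg_mul, mul_assoc, neg_add_cancel]
  have := constant_of_has_deriv_right_zero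
    (fun x hx => (hD x hx).continuousAt.continuousWithinAt)
    (fun x hx => (hD x (Set.Ico_subset_Icc_self hx)).hasDerivWithinAt) b (Set.right_mem_Icc.2 hab)
  simpa [hL] using this

/-- Continuity of a parametric integral over a compact interval. -/
theorem continuousAt_intervalIntegral {X F : Type*} [TopologicalSpace X] [NormedAddCommGroup F]
    [NormedSpace ℝ F] {f : X → ℝ → F} {x₀ : X} {a b : ℝ}
    (hf : ∀ t ∈ Set.uIcc a b, ContinuousAt (fun p : X × ℝ => f p.1 p.2) (x₀, t))
    (hx : ∀ᶠ x in 𝓝 x₀, ContinuousOn (f x) (Set.uIcc a b)) :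
    ContinuousAt (fun x => ∫ t in a..b, f x t) x₀ := by
  rw [ContinuousAt, Metric.tendsto_nhds]
  intro e he
  -- The `+ 1` keeps the denominator positive when `a = b`.
  set d : ℝ := e / (|b - a| + 1) with hd
  have hpos : 0 < |b - a| + 1 := by positivity
  have hd0 : 0 < d := div_pos he hpos
  have key : ∀ᶠ x in 𝓝 x₀, ∀ t ∈ Set.uIcc a b, dist (f x t) (f x₀ t) < d := by
    refine isCompact_uIcc.eventually_forall_of_forall_eventually
      (P := fun x t => dist (f x t) (f x₀ t) < d) fun t ht => ?_
    have h1 := hf t ht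
    have h2 : ContinuousAt (fun p : X × ℝ => f x₀ p.2) (x₀, t) :=
      ContinuousAt.comp (g := fun p : X × ℝ => f p.1 p.2) (f := fun p : X × ℝ => (x₀, p.2))
        (x := (x₀, t)) h1 (by fun_prop)
    have h3 := h1.dist h2
    refine h3.eventually_lt continuousAt_const ?_
    simpa using hd0
  filter_upwards [key, hx] with x h1 h2
  rw [dist_eq_norm, ← intervalIntegral.integral_sub h2.intervalIntegrable
    hx.self_of_nhds.intervalIntegrable]
  calc ‖∫ t in a..b, f x t - f x₀ t‖ ≤ d * |b - a| :=
        intervalIntegral.norm_integral_le_of_norm_le_const fun t ht => by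
          rw [← dist_eq_norm]; exact (h1 t (Set.uIoc_subset_uIcc ht)).le
    _ < d * (|b - a| + 1) := by nlinarith
    _ = e := by rw [hd]; field_simp

/-! ### Eigenvectors and invertibility of complex matrices. -/

variable {n : ℕ}

theorem mem_spectrum_iff_exists_mulVec {M : Matrix (Fin n) (Fin n) ℂ} {μ : ℂ} :
    μ ∈ spectrum ℂ M ↔ ∃ v, v ≠ 0 ∧ M *ᵥ v = μ • v := by
  rw [← Matrix.spectrum_toLin', ← Module.End.hasEigenvalue_iff_mem_spectrum]
  constructor
  · intro h
    obtain ⟨v, hv⟩ := h.exists_hasEigenvector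
    exact ⟨v, hv.2, by simpa using hv.apply_eq_smul⟩
  · rintro ⟨v, hv, h⟩
    exact Module.End.hasEigenvalue_of_hasEigenvector (x := v)
      ⟨Module.End.mem_eigenspace_iff.2 (by simpa using h), hv⟩

/-- A matrix commuting with `N` has an eigenvector in any nonzero eigenspace of `N`. -/
theorem exists_common_eigenvector {N M : Matrix (Fin n) (Fin n) ℂ} (h : Commute N M) {ν : ℂ}
    (hN : ∃ v, v ≠ 0 ∧ N *ᵥ v = ν • v) :
    ∃ v, v ≠ 0 ∧ N *ᵥ v = ν • v ∧ ∃ μ : ℂ, M *ᵥ v = μ • v := by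
  set p := Module.End.eigenspace (Matrix.toLin' N) ν
  have hmaps : ∀ x ∈ p, Matrix.toLin' M x ∈ p := by
    intro x hx
    rw [Module.End.mem_eigenspace_iff, Matrix.toLin'_apply] at *
    rw [Matrix.toLin'_apply, Matrix.mulVec_mulVec, h.eq, ← Matrix.mulVec_mulVec, hx,
      Matrix.mulVec_smul]
  obtain ⟨v, hv, hNv⟩ := hN
  have hvp : v ∈ p := by
    rw [Module.End.mem_eigenspace_iff, Matrix.toLin'_apply]; exact hNv
  have : Nontrivial p := ⟨⟨⟨v, hvp⟩, 0, fun h => hv (congrArg Subtype.val h)⟩⟩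
  obtain ⟨μ, hμ⟩ := Module.End.exists_eigenvalue ((Matrix.toLin' M).restrict hmaps)
  obtain ⟨w, hw⟩ := hμ.exists_hasEigenvector
  refine ⟨w, fun h => hw.2 (Subtype.ext h), ?_, μ, ?_⟩
  · have := w.2
    rwa [Module.End.mem_eigenspace_iff, Matrix.toLin'_apply] at this
  · have := congrArg Subtype.val hw.apply_eq_smul
    simpa using this

theorem isUnit_of_mulVec_ne {M : Matrix (Fin n) (Fin n) ℂ} (h : ∀ v, M *ᵥ v = 0 → v = 0) :
    IsUnit M := by
  rw [Matrix.isUnit_iff_isUnit_det, isUnit_iff_ne_zero]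
  intro hd
  obtain ⟨v, hv, hv0⟩ := Matrix.exists_mulVec_eq_zero_iff.2 hd
  exact hv (h v hv0)

theorem continuousAt_inv {X : Type*} [TopologicalSpace X]
    {f : X → Matrix (Fin n) (Fin n) ℂ} {x : X} (hf : ContinuousAt f x) (h : IsUnit (f x)) :
    ContinuousAt (fun y => (f y)⁻¹) x := by
  have hd : (f x).det ≠ 0 := by
    rwa [Matrix.isUnit_iff_isUnit_det, isUnit_iff_ne_zero] at h
  have h1 : ContinuousAt (fun y => (f y).det) x :=
    (Continuous.matrix_det continuous_id).continuousAt.comp hf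
  have h2 : ContinuousAt (fun y => (f y).adjugate) x :=
    (Continuous.matrix_adjugate continuous_id).continuousAt.comp hf
  simp only [Matrix.inv_def, Ring.inverse_eq_inv']
  exact (h1.inv₀ hd).smul h2

theorem eventually_isUnit {X : Type*} [TopologicalSpace X]
    {f : X → Matrix (Fin n) (Fin n) ℂ} {x : X} (hf : ContinuousAt f x) (h : IsUnit (f x)) :
    ∀ᶠ y in 𝓝 x, IsUnit (f y) := by
  have hd : (f x).det ≠ 0 := by
    rwa [Matrix.isUnit_iff_isUnit_det, isUnit_iff_ne_zero] at h
  have h1 : ContinuousAt (fun y => (f y).det) x :=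
    (Continuous.matrix_det continuous_id).continuousAt.comp hf
  filter_upwards [h1.eventually_ne hd] with y hy
  rwa [Matrix.isUnit_iff_isUnit_det, isUnit_iff_ne_zero]

/-! ### The function `ψ₁`. -/

section
open scoped Matrix.Norms.Operator

/-- The factor `‖1‖` settles the case `k = 0` without requiring `‖1‖ = 1`, which fails for `n = 0`.
-/
theorem norm_psi1_term_le (X : Matrix (Fin n) (Fin n) ℂ) {r : ℝ} (hX : ‖X‖ ≤ r) (k : ℕ) :
    ‖((Nat.factorial (k + 1) : ℂ)⁻¹) • X ^ k‖ ≤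
      ‖(1 : Matrix (Fin n) (Fin n) ℂ)‖ * (r ^ k / (Nat.factorial k : ℝ)) := by
  have h1 : ‖X ^ k‖ ≤ ‖(1 : Matrix (Fin n) (Fin n) ℂ)‖ * r ^ k := by
    induction k with
    | zero => simp
    | succ k ih =>
      rw [pow_succ, pow_succ, ← mul_assoc]
      exact (norm_mul_le _ _).trans (mul_le_mul ih hX (norm_nonneg _)
        ((norm_nonneg _).trans ih))
  have h2 : ((Nat.factorial (k + 1) : ℝ))⁻¹ ≤ ((Nat.factorial k : ℝ))⁻¹ := by
    apply inv_anti₀ (by positivity)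
    exact_mod_cast Nat.factorial_le (Nat.le_succ k)
  rw [norm_smul, norm_inv, Complex.norm_natCast]
  calc _ ≤ ((Nat.factorial k : ℝ))⁻¹ * (‖(1 : Matrix (Fin n) (Fin n) ℂ)‖ * r ^ k) :=
        mul_le_mul h2 h1 (norm_nonneg _) (by positivity)
    _ = _ := by ring

theorem summable_psi1 (X : Matrix (Fin n) (Fin n) ℂ) :
    Summable fun k : ℕ => ((Nat.factorial (k + 1) : ℂ)⁻¹) • X ^ k :=
  Summable.of_norm_bounded ((Real.summable_pow_div_factorial ‖X‖).mul_left _)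
    (norm_psi1_term_le X le_rfl)

theorem continuous_psi1 :
    Continuous (psi1 : Matrix (Fin n) (Fin n) ℂ → Matrix (Fin n) (Fin n) ℂ) := by
  rw [continuous_iff_continuousAt]
  intro X
  have h : ContinuousOn psi1 (Metric.closedBall (0 : Matrix (Fin n) (Fin n) ℂ) (‖X‖ + 1)) := by
    refine continuousOn_tsum (u := fun k => ‖(1 : Matrix (Fin n) (Fin n) ℂ)‖ *
      ((‖X‖ + 1) ^ k / (Nat.factorial k : ℝ))) (fun k => ?_) ?_ fun k Z hZ => ?_
    · exact Continuous.continuousOn (by fun_prop)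
    · exact (Real.summable_pow_div_factorial _).mul_left _
    · exact norm_psi1_term_le Z (by simpa using hZ) k
  refine h.continuousAt (Metric.closedBall_mem_nhds_of_mem ?_)
  simp

theorem continuous_exp_matrix :
    Continuous (NormedSpace.exp : Matrix (Fin n) (Fin n) ℂ → Matrix (Fin n) (Fin n) ℂ) := by
  let _ : NormedAlgebra ℚ (Matrix (Fin n) (Fin n) ℂ) := NormedAlgebra.restrictScalars ℚ ℂ _
  exact NormedSpace.exp_continuous

theorem exp_sub_one_eq_mul_psi1 (X : Matrix (Fin n) (Fin n) ℂ) :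
    NormedSpace.exp X - 1 = X * psi1 X := by
  have h := NormedSpace.exp_series_hasSum_exp' (𝕂 := ℂ) X
  have h1 := (hasSum_nat_add_iff' 1).2 h
  have h2 := (summable_psi1 X).hasSum.mul_left X
  simp only [Finset.range_one, Finset.sum_singleton, Nat.factorial_zero, Nat.cast_one, inv_one,
    pow_zero, one_smul] at h1
  refine h1.unique (h2.congr_fun ?_)
  intro k
  rw [mul_smul_comm, ← pow_succ']

theorem commute_psi1 (X : Matrix (Fin n) (Fin n) ℂ) : Commute X (psi1 X) :=
  Commute.tsum_right X fun k => ((Commute.refl X).pow_right k).smul_right _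

theorem exp_mulVec_of_eigenvector {X : Matrix (Fin n) (Fin n) ℂ} {v : Fin n → ℂ} {μ : ℂ}
    (h : X *ᵥ v = μ • v) : NormedSpace.exp X *ᵥ v = Complex.exp μ • v := by
  have hp : ∀ k : ℕ, X ^ k *ᵥ v = μ ^ k • v := by
    intro k
    induction k with
    | zero => simp
    | succ k ih => rw [pow_succ, ← Matrix.mulVec_mulVec, h, Matrix.mulVec_smul, ih, smul_smul,
        pow_succ']
  have h1 := (NormedSpace.exp_series_hasSum_exp' (𝕂 := ℂ) X).map
    (Matrix.mulVecBilin ℂ ℂ |>.flip v).toAddMonoidHom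
    (LinearMap.continuous_of_finiteDimensional (Matrix.mulVecBilin ℂ ℂ |>.flip v))
  have h2 := (NormedSpace.exp_series_hasSum_exp' (𝕂 := ℂ) μ).smul_const v
  rw [← Complex.exp_eq_exp_ℂ] at h2
  refine h1.unique (h2.congr_fun ?_)
  intro k
  simp [hp, smul_smul]

/-- The kernel of `ψ₁(X)` is invariant under `X`, so if nonzero it contains an eigenvector `w` of
`X`, with eigenvalue `μ`. From `e^X - 1 = X ψ₁(X)` follows `e^μ = 1`, hence `μ = 0`; but then the
series gives `ψ₁(X) w = w`, a contradiction. -/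
theorem isUnit_psi1 {X : Matrix (Fin n) (Fin n) ℂ}
    (h : ∀ μ ∈ spectrum ℂ X, Complex.exp μ = 1 → μ = 0) : IsUnit (psi1 X) := by
  apply isUnit_of_mulVec_ne
  by_contra! hcon
  obtain ⟨v, hv0, hv⟩ := hcon
  obtain ⟨w, hw, hw0, μ, hμ⟩ := exists_common_eigenvector (N := psi1 X) (M := X) (ν := 0)
    (commute_psi1 X).symm ⟨v, hv, by simpa using hv0⟩
  rw [zero_smul] at hw0
  have h1 : (NormedSpace.exp X - 1) *ᵥ w = 0 := by
    rw [exp_sub_one_eq_mul_psi1, ← Matrix.mulVec_mulVec, hw0, Matrix.mulVec_zero]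
  rw [Matrix.sub_mulVec, exp_mulVec_of_eigenvector hμ, Matrix.one_mulVec, sub_eq_zero] at h1
  have h2 : Complex.exp μ = 1 := by
    by_contra hne
    have : (Complex.exp μ - 1) • w = 0 := by rw [sub_smul, h1, one_smul, sub_self]
    rcases smul_eq_zero.1 this with h | h
    · exact hne (sub_eq_zero.1 h)
    · exact hw h
  have h3 := h μ (mem_spectrum_iff_exists_mulVec.2 ⟨w, hw, hμ⟩) h2
  rw [h3, zero_smul] at hμ
  have hp : psi1 X *ᵥ w = w := by
    have h1 := (summable_psi1 X).hasSum.map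
      (Matrix.mulVecBilin ℂ ℂ |>.flip w).toAddMonoidHom
      (LinearMap.continuous_of_finiteDimensional (Matrix.mulVecBilin ℂ ℂ |>.flip w))
    refine h1.unique ((hasSum_ite_eq 0 w).congr_fun ?_)
    intro k
    cases k with
    | zero => simp
    | succ k => simp [pow_succ, hμ]
  exact hw (hp ▸ hw0)

end

/-! ### Uniqueness of the principal logarithm. -/

theorem exp_eq_one_of_abs_im_lt {μ : ℂ} (h : Complex.exp μ = 1) (him : |μ.im| < 2 * Real.pi) :
    μ = 0 := by
  obtain ⟨k, hk⟩ := Complex.exp_eq_one_iff.1 h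
  have hpi := Real.pi_pos
  have h1 : μ.im = k * (2 * Real.pi) := by rw [hk]; simp
  have h2 : k = 0 := by
    rw [h1, abs_mul, abs_of_pos (by positivity : 0 < 2 * Real.pi)] at him
    have : |(k : ℝ)| < 1 := by
      by_contra! hc
      nlinarith
    rw [← Int.cast_abs] at this
    exact Int.abs_lt_one_iff.1 (by exact_mod_cast this)
  rw [hk, h2]; simp


theorem commute_inv {Z M : Matrix (Fin n) (Fin n) ℂ} (h : Commute Z M) : Commute Z M⁻¹ := by
  simpa using Matrix.Commute.zpow_right h (-1)

theorem inv_mulVec_of_eigenvector {M : Matrix (Fin n) (Fin n) ℂ} (hM : IsUnit M)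
    {v : Fin n → ℂ} {μ : ℂ} (hv : v ≠ 0) (h : M *ᵥ v = μ • v) :
    μ ≠ 0 ∧ M⁻¹ *ᵥ v = μ⁻¹ • v := by
  have hd := (Matrix.isUnit_iff_isUnit_det M).1 hM
  have h1 : v = μ • M⁻¹ *ᵥ v := by
    rw [← Matrix.mulVec_smul, ← h, Matrix.mulVec_mulVec, Matrix.nonsing_inv_mul _ hd,
      Matrix.one_mulVec]
  have hμ : μ ≠ 0 := by
    rintro rfl
    rw [zero_smul] at h1
    exact hv h1
  refine ⟨hμ, ?_⟩
  conv_rhs => rw [h1]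
  rw [smul_smul, inv_mul_cancel₀ hμ, one_smul]

/-- A principal logarithm commuting with the commutant of `X` is the only one. -/
theorem IsPrincipalLog.eq_of_commute {X L Q : Matrix (Fin n) (Fin n) ℂ}
    (hL : IsPrincipalLog X L) (hc : ∀ M, Commute M X → Commute M L)
    (hQ : IsPrincipalLog X Q) : Q = L := by
  have hQX : Commute Q X := by
    have := (Commute.refl Q).exp_right
    rwa [hQ.1] at this
  have hQL : Commute Q L := hc Q hQX
  have hexp : NormedSpace.exp (Q - L) = 1 := by
    rw [sub_eq_add_neg, Matrix.exp_add_of_commute _ _ hQL.neg_right, hQ.1, ← hL.1,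
      ← Matrix.exp_add_of_commute _ _ (Commute.refl L).neg_right, add_neg_cancel,
      NormedSpace.exp_zero]
  -- On a common eigenvector, `μ` is a difference of two numbers in the strip `|im| < π`, so `|im μ|
  -- < 2π`.
  have hspec : ∀ μ ∈ spectrum ℂ (Q - L), Complex.exp μ = 1 → μ = 0 := by
    intro μ hμ hμ1
    obtain ⟨v, hv, hD, q, hq⟩ := exists_common_eigenvector (N := Q - L) (M := Q)
      ((Commute.refl Q).sub_left hQL.symm) (mem_spectrum_iff_exists_mulVec.1 hμ)
    have hl : L *ᵥ v = (q - μ) • v := by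
      rw [Matrix.sub_mulVec, hq] at hD
      rw [sub_smul, ← hD]; abel
    obtain ⟨h1, h2⟩ := hQ.2 q (mem_spectrum_iff_exists_mulVec.2 ⟨v, hv, hq⟩)
    obtain ⟨h3, h4⟩ := hL.2 _ (mem_spectrum_iff_exists_mulVec.2 ⟨v, hv, hl⟩)
    rw [Complex.sub_im] at h3 h4
    exact exp_eq_one_of_abs_im_lt hμ1 (abs_lt.2 ⟨by linarith, by linarith⟩)
  have hu := isUnit_psi1 hspec
  -- With `D = Q - L`, `0 = e^D - 1 = D ψ₁(D)`, and the second factor is invertible.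
  have h0 : (Q - L) * psi1 (Q - L) = 0 := by
    rw [← exp_sub_one_eq_mul_psi1, hexp, sub_self]
  exact sub_eq_zero.1 ((hu.mul_left_eq_zero).1 h0)

theorem IsPrincipalLog.principalLog_eq {X L : Matrix (Fin n) (Fin n) ℂ}
    (hL : IsPrincipalLog X L) (hc : ∀ M, Commute M X → Commute M L) :
    principalLog X = L := by
  have h : ∃! Q, IsPrincipalLog X Q := ⟨L, hL, fun Q hQ => hL.eq_of_commute hc hQ⟩
  rw [principalLog, dif_pos h]
  exact hL.eq_of_commute hc h.choose_spec.1

/-! ### The half-circle path and its principal logarithm. -/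

/-- `sin (θ/2) I - j cos (θ/2) R`. -/
noncomputable def arcPath (R : Matrix (Fin n) (Fin n) ℂ) (θ : ℝ) : Matrix (Fin n) (Fin n) ℂ :=
  Complex.sin (θ / 2) • 1 - (Complex.I * Complex.cos (θ / 2)) • R

/-- The derivative of `arcPath R`. -/
noncomputable def arcPathDeriv (R : Matrix (Fin n) (Fin n) ℂ) (θ : ℝ) : Matrix (Fin n) (Fin n) ℂ :=
  (Complex.cos (θ / 2) / 2) • 1 + (Complex.I * Complex.sin (θ / 2) / 2) • R

theorem hasDerivAt_sin_half (θ : ℝ) :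
    HasDerivAt (fun θ : ℝ => Complex.sin (θ / 2)) (Complex.cos (θ / 2) / 2) θ := by
  have h := ((hasDerivAt_id (θ : ℂ)).div_const 2).csin.comp_ofReal
  simpa [div_eq_mul_inv] using h

theorem hasDerivAt_I_mul_cos_half (θ : ℝ) :
    HasDerivAt (fun θ : ℝ => Complex.I * Complex.cos (θ / 2))
      (-(Complex.I * Complex.sin (θ / 2) / 2)) θ := by
  have h := (((hasDerivAt_id (θ : ℂ)).div_const 2).ccos.const_mul Complex.I).comp_ofReal
  refine h.congr_deriv ?_
  simp only [id]
  ring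

/-- A half-circle path `sin (θ/2) - j r cos (θ/2)` without zeros on `[θ₁, π]` avoids the closed
negative half-axis. -/
theorem arc_mem_slitPlane {θ₁ : ℝ} (hθ₁ : θ₁ ∈ Set.Ioo (-Real.pi) Real.pi) {r : ℂ}
    (h : ∀ θ ∈ Set.Icc θ₁ Real.pi,
      Complex.sin (θ / 2) - Complex.I * Complex.cos (θ / 2) * r ≠ 0)
    {θ : ℝ} (hθ : θ ∈ Set.Icc θ₁ Real.pi) :
    Complex.sin (θ / 2) - Complex.I * Complex.cos (θ / 2) * r ∈ Complex.slitPlane := by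
  rcases hθ.2.eq_or_lt with rfl | hlt
  · rw [Complex.sin_pi_div_two, Complex.cos_pi_div_two]; simp
  by_contra hcon
  rw [Complex.mem_slitPlane_iff] at hcon
  push Not at hcon
  obtain ⟨hre, him⟩ := hcon
  have hc : 0 < Real.cos (θ / 2) :=
    Real.cos_pos_of_mem_Ioo ⟨by linarith [hθ₁.1, hθ.1], by linarith⟩
  have e1 : Complex.sin (θ / 2) = (Real.sin (θ / 2) : ℝ) := by push_cast; rfl
  have e2 : Complex.cos (θ / 2) = (Real.cos (θ / 2) : ℝ) := by push_cast; rfl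
  rw [e1, e2] at hre him
  simp only [Complex.sub_re, Complex.sub_im, Complex.ofReal_re, Complex.ofReal_im,
    Complex.mul_re, Complex.mul_im, Complex.I_re, Complex.I_im] at hre him
  -- A value on the closed negative axis forces `j r = t` to be real with `tan(θ/2) ≤ t`. The path
  -- then vanishes at `2 arctan t ∈ [θ, π)`, which the hypothesis excludes.
  have hr : r.re = 0 := by nlinarith
  set t : ℝ := -r.im with ht
  have hrt : Complex.I * r = t := by
    apply Complex.ext <;> simp [hr, ht]
  have htan : Real.tan (θ / 2) ≤ t := by
    rw [Real.tan_eq_sin_div_cos, div_le_iff₀ hc]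
    nlinarith
  have hatan : θ / 2 ≤ Real.arctan t := by
    rw [← Real.arctan_tan (x := θ / 2) (by linarith [hθ₁.1, hθ.1]) (by linarith)]
    exact Real.arctan_mono htan
  refine h (2 * Real.arctan t) ⟨by linarith [hθ.1], by linarith [Real.arctan_lt_pi_div_two t]⟩ ?_
  have e3 : (((2 * Real.arctan t : ℝ) : ℂ) / 2) = (Real.arctan t : ℝ) := by push_cast; ring
  rw [e3, mul_right_comm, hrt, ← Complex.ofReal_sin, ← Complex.ofReal_cos, ← Complex.ofReal_mul,
    ← Complex.ofReal_sub]
  have h4 : t * Real.cos (Real.arctan t) = Real.sin (Real.arctan t) := by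
    conv_lhs => rw [← Real.tan_arctan t, Real.arctan_tan (Real.neg_pi_div_two_lt_arctan t)
      (Real.arctan_lt_pi_div_two t)]
    exact Real.tan_mul_cos (Real.cos_arctan_pos t).ne'
  rw [h4, sub_self, Complex.ofReal_zero]

theorem commute_arcPath {Z R : Matrix (Fin n) (Fin n) ℂ} (h : Commute Z R) (θ : ℝ) :
    Commute Z (arcPath R θ) :=
  ((Commute.one_right Z).smul_right _).sub_right (h.smul_right _)

theorem commute_arcPathDeriv {Z R : Matrix (Fin n) (Fin n) ℂ} (h : Commute Z R) (θ : ℝ) :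
    Commute Z (arcPathDeriv R θ) :=
  ((Commute.one_right Z).smul_right _).add_right (h.smul_right _)

theorem commute_arcPath_logDeriv {Z R : Matrix (Fin n) (Fin n) ℂ} (h : Commute Z R) (θ : ℝ) :
    Commute Z (arcPathDeriv R θ * (arcPath R θ)⁻¹) :=
  (commute_arcPathDeriv h θ).mul_right (commute_inv (commute_arcPath h θ))

theorem continuous_arcPath (R : Matrix (Fin n) (Fin n) ℂ) : Continuous (arcPath R) := by
  unfold arcPath; fun_prop

theorem continuous_arcPathDeriv (R : Matrix (Fin n) (Fin n) ℂ) :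
    Continuous (arcPathDeriv R) := by
  unfold arcPathDeriv; fun_prop

theorem cos_half_pos {θ₁ : ℝ} (hθ₁ : θ₁ ∈ Set.Ioo (-Real.pi) Real.pi) :
    0 < Real.cos (θ₁ / 2) :=
  Real.cos_pos_of_mem_Ioo ⟨by linarith [hθ₁.1], by linarith [hθ₁.2]⟩

theorem exp_smul_one_add (c : ℂ) (M : Matrix (Fin n) (Fin n) ℂ) :
    NormedSpace.exp (c • 1 + M) = Complex.exp c • NormedSpace.exp M := by
  rw [Matrix.exp_add_of_commute _ _ ((Commute.one_left M).smul_left c),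
    Matrix.smul_one_eq_diagonal, Matrix.exp_diagonal]
  have h : NormedSpace.exp (fun _ : Fin n => c) = fun _ => Complex.exp c := by
    funext i
    rw [Pi.coe_exp, Complex.exp_eq_exp_ℂ]
  rw [h, ← Matrix.smul_one_eq_diagonal, smul_mul_assoc, one_mul]

section
open scoped Matrix.Norms.Operator

theorem hasDerivAt_arcPath (R : Matrix (Fin n) (Fin n) ℂ) (θ : ℝ) :
    HasDerivAt (arcPath R) (arcPathDeriv R θ) θ := by
  have h := ((hasDerivAt_sin_half θ).smul_const (1 : Matrix (Fin n) (Fin n) ℂ)).sub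
    ((hasDerivAt_I_mul_cos_half θ).smul_const R)
  refine h.congr_deriv ?_
  rw [arcPathDeriv, neg_smul, sub_neg_eq_add]

theorem continuousOn_arcPath_logDeriv (R : Matrix (Fin n) (Fin n) ℂ) :
    ContinuousOn (fun θ => arcPathDeriv R θ * (arcPath R θ)⁻¹) {θ | IsUnit (arcPath R θ)} :=
  fun _ hθ => ((continuous_arcPathDeriv R).continuousAt.mul
    (continuousAt_inv (continuous_arcPath R).continuousAt hθ)).continuousWithinAt

theorem isOpen_isUnit_arcPath (R : Matrix (Fin n) (Fin n) ℂ) :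
    IsOpen {θ | IsUnit (arcPath R θ)} :=
  isOpen_iff_mem_nhds.2 fun _ hθ => eventually_isUnit (continuous_arcPath R).continuousAt hθ

theorem isPrincipalLog_arcPath {θ₁ : ℝ} (hθ₁ : θ₁ ∈ Set.Ioo (-Real.pi) Real.pi)
    {R : Matrix (Fin n) (Fin n) ℂ} (h : ∀ θ ∈ Set.Icc θ₁ Real.pi, IsUnit (arcPath R θ)) :
    IsPrincipalLog (arcPath R θ₁)
      (-∫ θ in θ₁..Real.pi, arcPathDeriv R θ * (arcPath R θ)⁻¹) := by
  have hint := ((continuousOn_arcPath_logDeriv R).mono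
    (show Set.uIcc θ₁ Real.pi ⊆ _ by rw [Set.uIcc_of_le hθ₁.2.le]; exact h)).intervalIntegrable
      (μ := MeasureTheory.volume)
  constructor
  · have := exp_neg_integral_mul_eq (T := arcPath R) hθ₁.2.le (isOpen_isUnit_arcPath R) h
      (continuousOn_arcPath_logDeriv R)
      (fun θ hθ => (hasDerivAt_arcPath R θ).congr_deriv (by
        rw [mul_assoc, Matrix.nonsing_inv_mul _ ((Matrix.isUnit_iff_isUnit_det _).1 hθ), mul_one]))
      (fun x y => commute_arcPath_logDeriv (commute_arcPath_logDeriv (Commute.refl R) x).symm y)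
    rw [← this]
    have hpi : arcPath R Real.pi = 1 := by
      rw [arcPath, Complex.sin_pi_div_two, Complex.cos_pi_div_two]; simp
    rw [hpi, mul_one]
    rfl
  · intro μ hμ
    set S := ∫ θ in θ₁..Real.pi, arcPathDeriv R θ * (arcPath R θ)⁻¹ with hS
    -- Since `S` commutes with `R`, an eigenvalue of `-S` can be tested on a common eigenvector.
    -- There the integrand is the derivative of `log` along a scalar curve in the slit plane ending
    -- at `1`, so `μ` is the principal `log` of its starting value.
    have hRS : Commute R S := commute_intervalIntegral (commute_arcPath_logDeriv (Commute.refl R))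
    obtain ⟨v, hv, hSv, r, hr⟩ := exists_common_eigenvector (N := -S) (M := R)
      hRS.symm.neg_left (mem_spectrum_iff_exists_mulVec.1 hμ)
    have hT : ∀ θ : ℝ, arcPath R θ *ᵥ v =
        (Complex.sin (θ / 2) - Complex.I * Complex.cos (θ / 2) * r) • v := by
      intro θ
      rw [arcPath, Matrix.sub_mulVec, Matrix.smul_mulVec, Matrix.smul_mulVec, hr,
        Matrix.one_mulVec, smul_smul, sub_smul]
    have hinv := fun θ hθ => inv_mulVec_of_eigenvector (h θ hθ) hv (hT θ)
    have hslit := fun θ hθ => arc_mem_slitPlane hθ₁ (fun θ hθ => (hinv θ hθ).1) (θ := θ) hθ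
    have hderiv : ∀ θ ∈ Set.uIcc θ₁ Real.pi, HasDerivAt
        (fun θ : ℝ => Complex.log (Complex.sin (θ / 2) - Complex.I * Complex.cos (θ / 2) * r))
        ((Complex.cos (θ / 2) / 2 + Complex.I * Complex.sin (θ / 2) / 2 * r) /
          (Complex.sin (θ / 2) - Complex.I * Complex.cos (θ / 2) * r)) θ := by
      intro θ hθ
      rw [Set.uIcc_of_le hθ₁.2.le] at hθ
      have h1 := ((hasDerivAt_sin_half θ).sub
        ((hasDerivAt_I_mul_cos_half θ).mul_const r)).clog_real (hslit θ hθ)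
      refine h1.congr_deriv ?_
      rw [neg_mul, sub_neg_eq_add]
      rfl
    let ev : Matrix (Fin n) (Fin n) ℂ →L[ℂ] (Fin n → ℂ) :=
      LinearMap.toContinuousLinearMap ((Matrix.mulVecBilin ℂ ℂ).flip v)
    have hSv' : S *ᵥ v = (∫ θ in θ₁..Real.pi,
        (Complex.cos (θ / 2) / 2 + Complex.I * Complex.sin (θ / 2) / 2 * r) /
          (Complex.sin (θ / 2) - Complex.I * Complex.cos (θ / 2) * r)) • v := by
      rw [← intervalIntegral.integral_smul_const]
      refine (ev.intervalIntegral_comp_comm hint).symm.trans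
        (intervalIntegral.integral_congr fun θ hθ => ?_)
      rw [Set.uIcc_of_le hθ₁.2.le] at hθ
      change (arcPathDeriv R θ * (arcPath R θ)⁻¹) *ᵥ v = _
      rw [← Matrix.mulVec_mulVec, (hinv θ hθ).2, Matrix.mulVec_smul, arcPathDeriv,
        Matrix.add_mulVec, Matrix.smul_mulVec, Matrix.smul_mulVec, hr, Matrix.one_mulVec,
        smul_smul, ← add_smul, smul_smul]
      simp only [div_eq_mul_inv, mul_comm]
    rw [intervalIntegral.integral_eq_sub_of_hasDerivAt hderiv] at hSv'
    · rw [Complex.sin_pi_div_two, Complex.cos_pi_div_two, mul_zero, zero_mul, sub_zero,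
        Complex.log_one, zero_sub, neg_smul] at hSv'
      rw [Matrix.neg_mulVec, hSv', neg_neg] at hSv
      have hμ' : Complex.log (Complex.sin (θ₁ / 2) - Complex.I * Complex.cos (θ₁ / 2) * r) = μ := by
        by_contra hne
        have : (Complex.log (Complex.sin (θ₁ / 2) - Complex.I * Complex.cos (θ₁ / 2) * r) - μ) • v
            = 0 := by rw [sub_smul, hSv, sub_self]
        rcases smul_eq_zero.1 this with h | h
        · exact hne (sub_eq_zero.1 h)
        · exact hv h
      rw [← hμ']
      refine ⟨by rw [Complex.log_im]; exact Complex.neg_pi_lt_arg _, ?_⟩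
      rw [Complex.log_im]
      exact lt_of_le_of_ne (Complex.arg_le_pi _)
        (Complex.slitPlane_arg_ne_pi (hslit θ₁ (Set.left_mem_Icc.2 hθ₁.2.le)))
    · refine ContinuousOn.intervalIntegrable ?_
      rw [Set.uIcc_of_le hθ₁.2.le]
      exact ContinuousOn.div (by fun_prop) (by fun_prop) fun θ hθ => (hinv θ hθ).1


end

/-! ### The path of the Cayley transform and the pencil. -/

theorem sin_sub_I_mul_cos (z : ℂ) :
    Complex.sin z - Complex.I * Complex.cos z = -(Complex.I * Complex.exp (z * Complex.I)) := by
  rw [Complex.exp_mul_I]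
  linear_combination Complex.sin z * Complex.I_sq

theorem sin_add_I_mul_cos (z : ℂ) :
    Complex.sin z + Complex.I * Complex.cos z = Complex.I * Complex.exp (-z * Complex.I) := by
  rw [Complex.exp_mul_I, Complex.cos_neg, Complex.sin_neg]
  linear_combination Complex.sin z * Complex.I_sq

/-- After factoring out `(E + A)⁻¹`, the coefficients of `E` and `A` are `sin(θ/2) ∓ j cos(θ/2)`,
which are exponentials. -/
theorem arcPath_pencil {A E : Matrix (Fin n) (Fin n) ℂ} (hp : IsUnit (E + A)) (θ : ℝ) :
    arcPath ((E - A) * (E + A)⁻¹) θ = (-(Complex.I * Complex.exp (-(θ / 2) * Complex.I))) •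
      ((Complex.exp (θ * Complex.I) • E - A) * (E + A)⁻¹) := by
  have h1 : (1 : Matrix (Fin n) (Fin n) ℂ) = (E + A) * (E + A)⁻¹ :=
    (Matrix.mul_nonsing_inv _ ((Matrix.isUnit_iff_isUnit_det _).1 hp)).symm
  have h2 : Complex.exp (-(θ / 2) * Complex.I) * Complex.exp (θ * Complex.I) =
      Complex.exp (θ / 2 * Complex.I) := by
    rw [← Complex.exp_add]; congr 1; ring
  rw [arcPath]
  conv_lhs => rw [h1]
  rw [← smul_mul_assoc, ← smul_mul_assoc, ← sub_mul, ← smul_mul_assoc]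
  congr 1
  have h3 := sin_sub_I_mul_cos (θ / 2)
  have h4 := sin_add_I_mul_cos (θ / 2)
  rw [← h2] at h3
  ext i j
  simp only [Matrix.sub_apply, Matrix.add_apply, Matrix.smul_apply, smul_eq_mul]
  linear_combination h3 * E i j + h4 * A i j

theorem isUnit_arcPath_pencil {A E : Matrix (Fin n) (Fin n) ℂ} (hp : IsUnit (E + A)) {θ : ℝ}
    (h : IsUnit (Complex.exp (θ * Complex.I) • E - A)) :
    IsUnit (arcPath ((E - A) * (E + A)⁻¹) θ) := by
  rw [arcPath_pencil hp]
  have hne : -(Complex.I * Complex.exp (-(θ / 2) * Complex.I)) ≠ 0 :=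
    neg_ne_zero.2 (mul_ne_zero Complex.I_ne_zero (Complex.exp_ne_zero _))
  have := (h.mul (Matrix.isUnit_nonsing_inv_iff.2 hp)).smul (Units.mk0 _ hne)
  exact this

/-- With `T` the path, `T' = (j/2) T + e^{-jθ/2} A (E + A)⁻¹`, and `A (E + A)⁻¹` is `j e^{jθ/2} A K
T`; multiplying by `T⁻¹` leaves the transfer function `K`. -/
theorem arcPath_pencil_logDeriv {A E : Matrix (Fin n) (Fin n) ℂ} (hp : IsUnit (E + A)) {θ : ℝ}
    (h : IsUnit (Complex.exp (θ * Complex.I) • E - A)) :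
    arcPathDeriv ((E - A) * (E + A)⁻¹) θ * (arcPath ((E - A) * (E + A)⁻¹) θ)⁻¹ =
      (Complex.I / 2) • 1 + Complex.I • (A * transfer A E (Complex.exp (θ * Complex.I))) := by
  have hpd := (Matrix.isUnit_iff_isUnit_det _).1 hp
  have hd := (Matrix.isUnit_iff_isUnit_det _).1 h
  have hTd := (Matrix.isUnit_iff_isUnit_det _).1 (isUnit_arcPath_pencil hp h)
  have h1 : (1 : Matrix (Fin n) (Fin n) ℂ) = (E + A) * (E + A)⁻¹ :=
    (Matrix.mul_nonsing_inv _ hpd).symm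
  have h5 : arcPathDeriv ((E - A) * (E + A)⁻¹) θ =
      (Complex.I / 2) • arcPath ((E - A) * (E + A)⁻¹) θ +
        Complex.exp (-(θ / 2) * Complex.I) • (A * (E + A)⁻¹) := by
    rw [arcPathDeriv, arcPath]
    conv_lhs => rw [h1]
    conv_rhs => rw [h1]
    simp only [← smul_mul_assoc, ← sub_mul, ← add_mul]
    congr 1
    rw [Complex.exp_mul_I, Complex.cos_neg, Complex.sin_neg]
    ext i j
    simp only [Matrix.add_apply, Matrix.sub_apply, Matrix.smul_apply, smul_eq_mul]
    linear_combination (Complex.cos (θ / 2) / 2 * (E i j - A i j)) * Complex.I_sq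
  have h6 : A * (E + A)⁻¹ = (Complex.I * Complex.exp (θ / 2 * Complex.I)) •
      (A * transfer A E (Complex.exp (θ * Complex.I)) * arcPath ((E - A) * (E + A)⁻¹) θ) := by
    rw [arcPath_pencil hp, transfer, mul_smul_comm, smul_smul, mul_assoc A, ← mul_assoc _⁻¹,
      Matrix.nonsing_inv_mul _ hd, one_mul]
    have : Complex.I * Complex.exp (θ / 2 * Complex.I) *
        -(Complex.I * Complex.exp (-(θ / 2) * Complex.I)) = 1 := by
      have : Complex.exp (θ / 2 * Complex.I) * Complex.exp (-(θ / 2) * Complex.I) = 1 := by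
        rw [← Complex.exp_add]; simp
      linear_combination -Complex.I ^ 2 * this - Complex.I_sq
    rw [this, one_smul]
  rw [h5, h6, smul_smul, add_mul, smul_mul_assoc, smul_mul_assoc, Matrix.mul_nonsing_inv _ hTd,
    mul_assoc (A * _), Matrix.mul_nonsing_inv _ hTd, mul_one]
  congr 2
  have : Complex.exp (-(θ / 2) * Complex.I) * Complex.exp (θ / 2 * Complex.I) = 1 := by
    rw [← Complex.exp_add]; simp
  linear_combination Complex.I * this

theorem tan_half_sub_I {θ₁ : ℝ} (hθ₁ : θ₁ ∈ Set.Ioo (-Real.pi) Real.pi) :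
    (Real.tan (θ₁ / 2) : ℂ) - Complex.I =
      -(Complex.I * Complex.exp (θ₁ / 2 * Complex.I)) / Complex.cos (θ₁ / 2) := by
  have hc : Complex.cos (θ₁ / 2) ≠ 0 := by
    have := (cos_half_pos hθ₁).ne'
    rw [← Complex.ofReal_ne_zero] at this
    simpa using this
  rw [← sin_sub_I_mul_cos, Complex.ofReal_tan, Complex.tan_eq_sin_div_cos]
  push_cast
  field_simp

theorem tan_half_sub_I_ne_zero (θ₁ : ℝ) : (Real.tan (θ₁ / 2) : ℂ) - Complex.I ≠ 0 := by
  intro h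
  have := congrArg Complex.im h
  simp [-Complex.ofReal_tan] at this

/-- The exponent has imaginary part `-(π - θ₁)/2 ∈ (-π, 0)`, so the principal `log` inverts `exp`
here. -/
theorem etaF_eq {θ₁ : ℝ} (hθ₁ : θ₁ ∈ Set.Ioo (-Real.pi) Real.pi) :
    etaF θ₁ = -(Real.log (Real.cos (θ₁ / 2)) : ℂ) - Complex.I * (Real.pi - θ₁) / 2 := by
  have hc := cos_half_pos hθ₁
  rw [etaF, tan_half_sub_I hθ₁]
  have h1 : -(Complex.I * Complex.exp (θ₁ / 2 * Complex.I)) / Complex.cos (θ₁ / 2) =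
      Complex.exp (-(Real.log (Real.cos (θ₁ / 2)) : ℂ) - Complex.I * (Real.pi - θ₁) / 2) := by
    rw [sub_eq_add_neg, Complex.exp_add, Complex.exp_neg, ← Complex.ofReal_exp, Real.exp_log hc]
    have h2 : -(Complex.I * (Real.pi - θ₁) / 2) =
        -(Real.pi / 2 * Complex.I) + θ₁ / 2 * Complex.I := by ring
    rw [h2, Complex.exp_add, Complex.exp_neg, Complex.exp_pi_div_two_mul_I, Complex.inv_I]
    push_cast
    ring
  rw [h1, Complex.log_exp]
  · simp; linarith [hθ₁.1, Real.pi_pos]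
  · simp; linarith [hθ₁.2, Real.pi_pos]

/-- This scalar identity makes the coefficients of `α` agree in the final formula. -/
theorem one_add_exp_add {θ₁ : ℝ} (hθ₁ : θ₁ ∈ Set.Ioo (-Real.pi) Real.pi) :
    1 + Complex.exp (-(θ₁ * Complex.I)) +
      2 * Complex.I * ((Real.tan (θ₁ / 2) : ℂ) - Complex.I)⁻¹ = 0 := by
  rw [tan_half_sub_I hθ₁, inv_div, Complex.cos]
  have h1 : Complex.exp (-(θ₁ * Complex.I)) = Complex.exp (-(θ₁ / 2) * Complex.I) ^ 2 := by
    rw [← Complex.exp_nat_mul]; congr 1; push_cast; ring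
  have h2 : Complex.exp (θ₁ / 2 * Complex.I) * Complex.exp (-(θ₁ / 2) * Complex.I) = 1 := by
    rw [← Complex.exp_add]; simp
  have h3 := Complex.exp_ne_zero (θ₁ / 2 * Complex.I)
  rw [h1]
  have hI := Complex.I_ne_zero
  generalize Complex.exp (θ₁ / 2 * Complex.I) = x at *
  generalize Complex.exp (-(θ₁ / 2) * Complex.I) = y at *
  field_simp
  linear_combination (y) * h2


/-! ### The logarithm as an integral of the transfer function. -/

/-- The pencil `e^{jθ} E - A` is regular for `θ ∈ [θ₁, π]`. -/
def RegularOnArc (A E : Matrix (Fin n) (Fin n) ℂ) (θ₁ : ℝ) : Prop :=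
  ∀ θ ∈ Set.Icc θ₁ Real.pi, IsUnit (Complex.exp (θ * Complex.I) • E - A)

/-- `t₁ I - j (E - A) (E + A)⁻¹`. -/
noncomputable def cayleyArg (A E : Matrix (Fin n) (Fin n) ℂ) (θ₁ : ℝ) :
    Matrix (Fin n) (Fin n) ℂ :=
  (Real.tan (θ₁ / 2) : ℂ) • 1 - Complex.I • ((E - A) * (E + A)⁻¹)

/-- `-η_f I + log (t₁ I - j (E - A) (E + A)⁻¹)`. -/
noncomputable def cayleyLog (A E : Matrix (Fin n) (Fin n) ℂ) (θ₁ : ℝ) :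
    Matrix (Fin n) (Fin n) ℂ :=
  -(etaF θ₁ • 1) + principalLog (cayleyArg A E θ₁)

/-- The integral of the transfer function over the arc from `θ₁` to `π`. -/
noncomputable def arcIntegral (A E : Matrix (Fin n) (Fin n) ℂ) (θ₁ : ℝ) :
    Matrix (Fin n) (Fin n) ℂ :=
  matrixIntegral (fun θ : ℝ => transfer A E (Complex.exp (θ * Complex.I))) θ₁ Real.pi

variable {A E : Matrix (Fin n) (Fin n) ℂ} {θ₁ : ℝ}

theorem RegularOnArc.isUnit_add (h : RegularOnArc A E θ₁) (hθ₁ : θ₁ ∈ Set.Ioo (-Real.pi) Real.pi) :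
    IsUnit (E + A) := by
  have h1 := h Real.pi (Set.right_mem_Icc.2 hθ₁.2.le)
  rw [Complex.exp_pi_mul_I, neg_one_smul] at h1
  have h2 := h1.neg
  rwa [neg_sub, sub_neg_eq_add, add_comm] at h2

theorem RegularOnArc.isUnit_arcPath (h : RegularOnArc A E θ₁)
    (hθ₁ : θ₁ ∈ Set.Ioo (-Real.pi) Real.pi) :
    ∀ θ ∈ Set.Icc θ₁ Real.pi, IsUnit (arcPath ((E - A) * (E + A)⁻¹) θ) :=
  fun θ hθ => isUnit_arcPath_pencil (h.isUnit_add hθ₁) (h θ hθ)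

theorem RegularOnArc.continuousOn_transfer (h : RegularOnArc A E θ₁)
    (hθ₁ : θ₁ ∈ Set.Ioo (-Real.pi) Real.pi) :
    ContinuousOn (fun θ : ℝ => transfer A E (Complex.exp (θ * Complex.I)))
      (Set.uIcc θ₁ Real.pi) := by
  intro θ hθ
  rw [Set.uIcc_of_le hθ₁.2.le] at hθ
  exact (continuousAt_inv (f := fun θ : ℝ => Complex.exp (θ * Complex.I) • E - A)
    (Continuous.continuousAt (by fun_prop)) (h θ hθ)).continuousWithinAt

theorem cayleyArg_eq (hθ₁ : θ₁ ∈ Set.Ioo (-Real.pi) Real.pi) :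
    cayleyArg A E θ₁ = Complex.exp (-(Real.log (Real.cos (θ₁ / 2)) : ℂ)) •
      arcPath ((E - A) * (E + A)⁻¹) θ₁ := by
  have hc := cos_half_pos hθ₁
  have hc' : Complex.cos (θ₁ / 2) ≠ 0 := by
    have := hc.ne'
    rw [← Complex.ofReal_ne_zero] at this
    simpa using this
  rw [Complex.exp_neg, ← Complex.ofReal_exp, Real.exp_log hc, cayleyArg, arcPath, smul_sub,
    smul_smul, smul_smul, Complex.ofReal_tan, Complex.tan_eq_sin_div_cos]
  push_cast
  congr 2
  · field_simp
  · field_simp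

theorem commute_of_commute_cayleyArg {M : Matrix (Fin n) (Fin n) ℂ}
    (h : Commute M (cayleyArg A E θ₁)) : Commute M ((E - A) * (E + A)⁻¹) := by
  have h1 : (E - A) * (E + A)⁻¹ =
      Complex.I • (cayleyArg A E θ₁ - (Real.tan (θ₁ / 2) : ℂ) • 1) := by
    rw [cayleyArg, sub_sub_cancel_left, smul_neg, smul_smul, Complex.I_mul_I, neg_one_smul, neg_neg]
  rw [h1]
  exact (h.sub_right ((Commute.one_right M).smul_right _)).smul_right _

section
open scoped Matrix.Norms.Operator

theorem matrixIntegral_eq {F : ℝ → Matrix (Fin n) (Fin n) ℂ} {a b : ℝ}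
    (hF : ContinuousOn F (Set.uIcc a b)) : matrixIntegral F a b = ∫ θ in a..b, F θ := by
  ext i k
  let entry : Matrix (Fin n) (Fin n) ℂ →L[ℂ] ℂ :=
    LinearMap.toContinuousLinearMap (Matrix.entryLinearMap ℂ ℂ i k)
  exact entry.intervalIntegral_comp_comm (hF.intervalIntegrable (μ := MeasureTheory.volume))

theorem integral_arcPath_logDeriv (h : RegularOnArc A E θ₁)
    (hθ₁ : θ₁ ∈ Set.Ioo (-Real.pi) Real.pi) :
    ∫ θ in θ₁..Real.pi,
      arcPathDeriv ((E - A) * (E + A)⁻¹) θ * (arcPath ((E - A) * (E + A)⁻¹) θ)⁻¹ =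
    (Complex.I * (Real.pi - θ₁) / 2) • 1 + Complex.I • (A * arcIntegral A E θ₁) := by
  have hc := h.continuousOn_transfer hθ₁
  let lm : Matrix (Fin n) (Fin n) ℂ →L[ℂ] Matrix (Fin n) (Fin n) ℂ :=
    LinearMap.toContinuousLinearMap (Complex.I • LinearMap.mulLeft ℂ A)
  have h1 := lm.intervalIntegral_comp_comm (hc.intervalIntegrable (μ := MeasureTheory.volume))
  have h2 : ∫ θ in θ₁..Real.pi,
      arcPathDeriv ((E - A) * (E + A)⁻¹) θ * (arcPath ((E - A) * (E + A)⁻¹) θ)⁻¹ =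
      ∫ θ in θ₁..Real.pi, ((Complex.I / 2) • (1 : Matrix (Fin n) (Fin n) ℂ) +
        lm (transfer A E (Complex.exp (θ * Complex.I)))) := by
    refine intervalIntegral.integral_congr fun θ hθ => ?_
    rw [Set.uIcc_of_le hθ₁.2.le] at hθ
    exact arcPath_pencil_logDeriv (h.isUnit_add hθ₁) (h θ hθ)
  have hlm : ContinuousOn (fun θ : ℝ => lm (transfer A E (Complex.exp (θ * Complex.I))))
      (Set.uIcc θ₁ Real.pi) := lm.continuous.comp_continuousOn hc
  rw [h2, intervalIntegral.integral_add (by simp) hlm.intervalIntegrable,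
    intervalIntegral.integral_const, arcIntegral, matrixIntegral_eq hc]
  refine congrArg₂ (· + ·) ?_ h1
  ext i j
  simp only [Matrix.smul_apply, Complex.real_smul, smul_eq_mul]
  push_cast
  ring

/-- Dividing the path by `cos(θ₁/2) > 0` shifts the logarithm by a real scalar, which keeps
eigenvalues in the strip. The commutation half supplies the uniqueness criterion for `principalLog`.
-/
theorem isPrincipalLog_cayleyArg_and_commute (h : RegularOnArc A E θ₁)
    (hθ₁ : θ₁ ∈ Set.Ioo (-Real.pi) Real.pi) :
    IsPrincipalLog (cayleyArg A E θ₁)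
      (etaF θ₁ • 1 - Complex.I • (A * arcIntegral A E θ₁)) ∧
    ∀ M, Commute M ((E - A) * (E + A)⁻¹) →
      Commute M (etaF θ₁ • 1 - Complex.I • (A * arcIntegral A E θ₁)) := by
  set S := ∫ θ in θ₁..Real.pi,
    arcPathDeriv ((E - A) * (E + A)⁻¹) θ * (arcPath ((E - A) * (E + A)⁻¹) θ)⁻¹ with hS
  have hlog := isPrincipalLog_arcPath hθ₁ (h.isUnit_arcPath hθ₁)
  have hE : etaF θ₁ • 1 - Complex.I • (A * arcIntegral A E θ₁) =
      (-(Real.log (Real.cos (θ₁ / 2)) : ℂ)) • 1 + -S := by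
    rw [hS, integral_arcPath_logDeriv h hθ₁, etaF_eq hθ₁, sub_smul]
    abel
  rw [hE]
  refine ⟨⟨?_, fun μ hμ => ?_⟩, fun M hM => ?_⟩
  · rw [exp_smul_one_add, cayleyArg_eq hθ₁, ← hlog.1]
  · obtain ⟨v, hv, hv'⟩ := mem_spectrum_iff_exists_mulVec.1 hμ
    have h1 : μ + Real.log (Real.cos (θ₁ / 2)) ∈ spectrum ℂ (-S) := by
      refine mem_spectrum_iff_exists_mulVec.2 ⟨v, hv, ?_⟩
      rw [Matrix.add_mulVec, Matrix.smul_mulVec, Matrix.one_mulVec] at hv'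
      rw [add_smul, ← hv', neg_smul]
      abel
    have h2 := hlog.2 _ h1
    rwa [Complex.add_im, Complex.ofReal_im, add_zero] at h2
  · exact ((Commute.one_right M).smul_right _).add_right
      (commute_intervalIntegral (commute_arcPath_logDeriv hM)).neg_right

theorem continuousAt_arcIntegral {X : Type*} [TopologicalSpace X]
    {A E : X → Matrix (Fin n) (Fin n) ℂ} {x : X} (hA : Continuous A) (hE : Continuous E)
    (hθ₁ : θ₁ ∈ Set.Ioo (-Real.pi) Real.pi) (h : ∀ᶠ y in 𝓝 x, RegularOnArc (A y) (E y) θ₁) :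
    ContinuousAt (fun y => arcIntegral (A y) (E y) θ₁) x := by
  have h1 : (fun y => arcIntegral (A y) (E y) θ₁) =ᶠ[𝓝 x] fun y =>
      ∫ θ in θ₁..Real.pi, transfer (A y) (E y) (Complex.exp (θ * Complex.I)) := by
    filter_upwards [h] with y hy
    exact matrixIntegral_eq (hy.continuousOn_transfer hθ₁)
  refine ContinuousAt.congr (continuousAt_intervalIntegral (fun t ht => ?_) ?_) h1.symm
  · rw [Set.uIcc_of_le hθ₁.2.le] at ht
    exact continuousAt_inv
      (f := fun p : X × ℝ => Complex.exp (p.2 * Complex.I) • E p.1 - A p.1)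
      (Continuous.continuousAt (by fun_prop)) (h.self_of_nhds t ht)
  · filter_upwards [h] with y hy
    exact hy.continuousOn_transfer hθ₁

end

theorem RegularOnArc.isPrincipalLog_cayleyArg (h : RegularOnArc A E θ₁)
    (hθ₁ : θ₁ ∈ Set.Ioo (-Real.pi) Real.pi) :
    IsPrincipalLog (cayleyArg A E θ₁)
      (etaF θ₁ • 1 - Complex.I • (A * arcIntegral A E θ₁)) :=
  (isPrincipalLog_cayleyArg_and_commute h hθ₁).1

theorem RegularOnArc.principalLog_cayleyArg (h : RegularOnArc A E θ₁)
    (hθ₁ : θ₁ ∈ Set.Ioo (-Real.pi) Real.pi) :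
    principalLog (cayleyArg A E θ₁) = etaF θ₁ • 1 - Complex.I • (A * arcIntegral A E θ₁) :=
  (h.isPrincipalLog_cayleyArg hθ₁).principalLog_eq fun M hM =>
    (isPrincipalLog_cayleyArg_and_commute h hθ₁).2 M (commute_of_commute_cayleyArg hM)

theorem RegularOnArc.cayleyLog_eq (h : RegularOnArc A E θ₁)
    (hθ₁ : θ₁ ∈ Set.Ioo (-Real.pi) Real.pi) :
    cayleyLog A E θ₁ = -(Complex.I • (A * arcIntegral A E θ₁)) := by
  rw [cayleyLog, h.principalLog_cayleyArg hθ₁]; abel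

theorem RegularOnArc.commute_cayleyLog (h : RegularOnArc A E θ₁)
    (hθ₁ : θ₁ ∈ Set.Ioo (-Real.pi) Real.pi) {M : Matrix (Fin n) (Fin n) ℂ}
    (hM : Commute M ((E - A) * (E + A)⁻¹)) : Commute M (cayleyLog A E θ₁) := by
  rw [cayleyLog, h.principalLog_cayleyArg hθ₁]
  exact ((Commute.one_right M).smul_right _).neg_right.add_right
    ((isPrincipalLog_cayleyArg_and_commute h hθ₁).2 M hM)

theorem RegularOnArc.exp_cayleyLog (h : RegularOnArc A E θ₁)
    (hθ₁ : θ₁ ∈ Set.Ioo (-Real.pi) Real.pi) :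
    NormedSpace.exp (cayleyLog A E θ₁) =
      ((Real.tan (θ₁ / 2) : ℂ) - Complex.I)⁻¹ • cayleyArg A E θ₁ := by
  rw [cayleyLog, ← neg_smul, exp_smul_one_add, h.principalLog_cayleyArg hθ₁,
    (h.isPrincipalLog_cayleyArg hθ₁).1, Complex.exp_neg, etaF,
    Complex.exp_log (tan_half_sub_I_ne_zero θ₁)]

theorem RegularOnArc.exp_cayleyLog_sub_one (h : RegularOnArc A E θ₁)
    (hθ₁ : θ₁ ∈ Set.Ioo (-Real.pi) Real.pi) :
    NormedSpace.exp (cayleyLog A E θ₁) - 1 =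
      (2 * Complex.I * ((Real.tan (θ₁ / 2) : ℂ) - Complex.I)⁻¹) • (A * (E + A)⁻¹) := by
  have h1 : (1 : Matrix (Fin n) (Fin n) ℂ) = (E + A) * (E + A)⁻¹ :=
    (Matrix.mul_nonsing_inv _ ((Matrix.isUnit_iff_isUnit_det _).1 (h.isUnit_add hθ₁))).symm
  have ht := tan_half_sub_I_ne_zero θ₁
  rw [h.exp_cayleyLog hθ₁, cayleyArg]
  conv_lhs => rw [h1]
  simp only [← smul_mul_assoc, ← sub_mul]
  congr 1
  ext i j
  simp only [Matrix.sub_apply, Matrix.add_apply, Matrix.smul_apply, smul_eq_mul]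
  generalize (Real.tan (θ₁ / 2) : ℂ) = t at *
  field_simp
  ring

/-- If `μ` is an eigenvalue of `Y`, then `μ + η_f` lies in the strip `|im| < π`; as `im η_f ∈ (-π,
0)`, this gives `|im μ| < 2π`. -/
theorem RegularOnArc.isUnit_psi1_cayleyLog (h : RegularOnArc A E θ₁)
    (hθ₁ : θ₁ ∈ Set.Ioo (-Real.pi) Real.pi) : IsUnit (psi1 (cayleyLog A E θ₁)) := by
  refine isUnit_psi1 fun μ hμ hμ1 => ?_
  obtain ⟨v, hv, hv'⟩ := mem_spectrum_iff_exists_mulVec.1 hμ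
  have h1 : μ + etaF θ₁ ∈ spectrum ℂ (etaF θ₁ • 1 - Complex.I • (A * arcIntegral A E θ₁)) := by
    refine mem_spectrum_iff_exists_mulVec.2 ⟨v, hv, ?_⟩
    rw [h.cayleyLog_eq hθ₁] at hv'
    rw [sub_eq_add_neg, Matrix.add_mulVec, hv', Matrix.smul_mulVec, Matrix.one_mulVec, add_smul,
      add_comm]
  obtain ⟨h2, h3⟩ := (h.isPrincipalLog_cayleyArg hθ₁).2 _ h1
  have h4 : (etaF θ₁).im = -((Real.pi - θ₁) / 2) := by
    rw [etaF_eq hθ₁]; simp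
  rw [Complex.add_im, h4] at h2 h3
  exact exp_eq_one_of_abs_im_lt hμ1
    (abs_lt.2 ⟨by linarith [hθ₁.1, hθ₁.2], by linarith [hθ₁.1, hθ₁.2]⟩)

theorem RegularOnArc.isUnit_exp_cayleyLog_sub_one (h : RegularOnArc A E θ₁)
    (hθ₁ : θ₁ ∈ Set.Ioo (-Real.pi) Real.pi) (hA : IsUnit A) :
    IsUnit (NormedSpace.exp (cayleyLog A E θ₁) - 1) := by
  rw [h.exp_cayleyLog_sub_one hθ₁]
  have hne : 2 * Complex.I * ((Real.tan (θ₁ / 2) : ℂ) - Complex.I)⁻¹ ≠ 0 :=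
    mul_ne_zero (mul_ne_zero two_ne_zero Complex.I_ne_zero)
      (inv_ne_zero (tan_half_sub_I_ne_zero θ₁))
  exact (hA.mul (Matrix.isUnit_nonsing_inv_iff.2 (h.isUnit_add hθ₁))).smul (Units.mk0 _ hne)

/-! ### The closed form for invertible `A`. -/

theorem inv_exp_sub_one_mul_self {Y : Matrix (Fin n) (Fin n) ℂ}
    (h : IsUnit (NormedSpace.exp Y - 1)) :
    (NormedSpace.exp Y - 1)⁻¹ * Y = (psi1 Y)⁻¹ := by
  rw [exp_sub_one_eq_mul_psi1] at h ⊢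
  have hY : IsUnit Y.det := by
    rw [Matrix.isUnit_iff_isUnit_det, Matrix.det_mul] at h
    exact isUnit_of_mul_isUnit_left h
  rw [Matrix.mul_inv_rev, mul_assoc, Matrix.nonsing_inv_mul _ hY, mul_one]

theorem RegularOnArc.arcIntegral_eq_of_isUnit (h : RegularOnArc A E θ₁)
    (hθ₁ : θ₁ ∈ Set.Ioo (-Real.pi) Real.pi) (hA : IsUnit A) {α β : ℂ}
    (hW : IsUnit (α • E + β • A)) :
    arcIntegral A E θ₁ = (1 / Complex.I) • ((α • E + β • A)⁻¹ * (psi1 (cayleyLog A E θ₁))⁻¹ *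
      ((α - β) • NormedSpace.exp (cayleyLog A E θ₁) +
        (Complex.exp (-(θ₁ * Complex.I)) * α + β) • (1 : Matrix (Fin n) (Fin n) ℂ))) := by
  set Y := cayleyLog A E θ₁ with hY
  set W := α • E + β • A with hWdef
  have hAd := (Matrix.isUnit_iff_isUnit_det _).1 hA
  have hWd := (Matrix.isUnit_iff_isUnit_det _).1 hW
  have hψ := (Matrix.isUnit_iff_isUnit_det _).1 (h.isUnit_psi1_cayleyLog hθ₁)
  have hp := h.isUnit_add hθ₁
  have hpd := (Matrix.isUnit_iff_isUnit_det _).1 hp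
  -- `R`, `W A⁻¹` and `e^Y` are all rational functions of `X`; this is the source of the commutation
  -- of `W A⁻¹` with `Y`.
  set X := E * A⁻¹ with hX
  have hE : E = X * A := by rw [hX, mul_assoc, Matrix.nonsing_inv_mul _ hAd, mul_one]
  have hZ : W * A⁻¹ = α • X + β • 1 := by
    rw [hWdef, add_mul, smul_mul_assoc, smul_mul_assoc, Matrix.mul_nonsing_inv _ hAd]
  have hsub : E - A = (X - 1) * A := by rw [sub_mul, one_mul, ← hE]
  have hadd : E + A = (X + 1) * A := by rw [add_mul, one_mul, ← hE]
  have hX1 : IsUnit (X + 1).det := by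
    rw [hadd, Matrix.det_mul] at hpd
    exact isUnit_of_mul_isUnit_left hpd
  have hR : (E - A) * (E + A)⁻¹ = (X - 1) * (X + 1)⁻¹ := by
    rw [hsub, hadd, Matrix.mul_inv_rev, mul_assoc, ← mul_assoc A,
      Matrix.mul_nonsing_inv _ hAd, one_mul]
  have hcX : Commute X ((E - A) * (E + A)⁻¹) := by
    rw [hR]
    exact ((Commute.refl X).sub_right (Commute.one_right X)).mul_right
      (commute_inv ((Commute.refl X).add_right (Commute.one_right X)))
  have hcZ : Commute (W * A⁻¹) Y := by
    rw [hZ]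
    exact ((h.commute_cayleyLog hθ₁ hcX).smul_left _).add_left ((Commute.one_left Y).smul_left _)
  have hB : (α - β) • NormedSpace.exp Y +
      (Complex.exp (-(θ₁ * Complex.I)) * α + β) • (1 : Matrix (Fin n) (Fin n) ℂ) =
      -((NormedSpace.exp Y - 1) * (W * A⁻¹)) := by
    set c := 2 * Complex.I * ((Real.tan (θ₁ / 2) : ℂ) - Complex.I)⁻¹ with hc
    have hP : A * (E + A)⁻¹ = (X + 1)⁻¹ := by
      rw [hadd, Matrix.mul_inv_rev, ← mul_assoc, Matrix.mul_nonsing_inv _ hAd, one_mul]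
    have hexp : NormedSpace.exp Y - 1 = c • (X + 1)⁻¹ := by
      rw [hY, h.exp_cayleyLog_sub_one hθ₁, hP]
    have hPX : (X + 1)⁻¹ * X = 1 - (X + 1)⁻¹ := by
      rw [eq_sub_iff_add_eq]
      conv_lhs => rw [← mul_one (X + 1)⁻¹]
      rw [mul_assoc, one_mul, ← mul_add, Matrix.nonsing_inv_mul _ hX1]
    have h1 := one_add_exp_add hθ₁
    rw [← hc] at h1
    rw [eq_add_of_sub_eq hexp, add_sub_cancel_right, hZ, mul_add, mul_smul_comm, mul_smul_comm,
      smul_mul_assoc, hPX, mul_one]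
    ext i j
    simp only [Matrix.add_apply, Matrix.sub_apply, Matrix.neg_apply, Matrix.smul_apply,
      smul_eq_mul]
    linear_combination (α * (1 : Matrix (Fin n) (Fin n) ℂ) i j) * h1
  have hYA : Y = -(Complex.I • (A * arcIntegral A E θ₁)) := h.cayleyLog_eq hθ₁
  have hmain : W⁻¹ * (psi1 Y)⁻¹ * -((NormedSpace.exp Y - 1) * (W * A⁻¹)) =
      Complex.I • arcIntegral A E θ₁ := by
    calc W⁻¹ * (psi1 Y)⁻¹ * -((NormedSpace.exp Y - 1) * (W * A⁻¹))
        = -(W⁻¹ * (((psi1 Y)⁻¹ * psi1 Y) * (Y * (W * A⁻¹)))) := by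
          rw [exp_sub_one_eq_mul_psi1, (commute_psi1 Y).eq]; noncomm_ring
      _ = -((W⁻¹ * W) * A⁻¹ * Y) := by
          rw [Matrix.nonsing_inv_mul _ hψ, one_mul, ← hcZ.eq]; noncomm_ring
      _ = Complex.I • ((A⁻¹ * A) * arcIntegral A E θ₁) := by
          rw [Matrix.nonsing_inv_mul _ hWd, one_mul, hYA, mul_neg, neg_neg, mul_smul_comm,
            mul_assoc]
      _ = _ := by rw [Matrix.nonsing_inv_mul _ hAd, one_mul]
  rw [hB, hmain, smul_smul, one_div, inv_mul_cancel₀ Complex.I_ne_zero, one_smul]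

/-! ### Perturbation of the pencil. -/

theorem eventually_isUnit_add_smul_one (A : Matrix (Fin n) (Fin n) ℂ) :
    ∀ᶠ z in 𝓝[≠] (0 : ℂ), IsUnit (A + z • (1 : Matrix (Fin n) (Fin n) ℂ)) := by
  have hfin : (spectrum ℂ (-A)).Finite := by
    rw [← Matrix.spectrum_toLin']
    exact Module.End.finite_spectrum _
  have h1 : ∀ᶠ z in 𝓝[≠] (0 : ℂ), z ∉ spectrum ℂ (-A) \ {0} :=
    nhdsWithin_le_nhds ((hfin.sdiff (t := {0})).isClosed.isOpen_compl.mem_nhds fun h => h.2 rfl)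
  filter_upwards [h1, self_mem_nhdsWithin] with z hz hz0
  have h2 : z ∉ spectrum ℂ (-A) := fun h => hz ⟨h, hz0⟩
  rw [spectrum.notMem_iff, Algebra.algebraMap_eq_smul_one, sub_neg_eq_add, add_comm] at h2
  exact h2

/-- For `α = 0` there is no perturbation of `A`, but then `W = βA` already makes `A` invertible;
otherwise `αε` avoids the finitely many nonzero eigenvalues of `-A`. -/
theorem eventually_isUnit_Aeps {α β : ℂ} (hW : IsUnit (α • E + β • A)) :
    ∀ᶠ ε in 𝓝[≠] (0 : ℂ), IsUnit (Aeps A α ε) := by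
  by_cases hα : α = 0
  · refine Eventually.of_forall fun ε => ?_
    rw [hα, zero_smul, zero_add] at hW
    rw [Aeps, hα, zero_mul, zero_smul, add_zero, Matrix.isUnit_iff_isUnit_det]
    rw [Matrix.isUnit_iff_isUnit_det, ← smul_one_mul, Matrix.det_mul] at hW
    exact isUnit_of_mul_isUnit_right hW
  · have ht : Tendsto (fun ε : ℂ => α * ε) (𝓝[≠] 0) (𝓝[≠] 0) := by
      refine tendsto_nhdsWithin_iff.2 ⟨?_, ?_⟩
      · have : Tendsto (fun ε : ℂ => α * ε) (𝓝 0) (𝓝 (α * 0)) :=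
          (continuous_const.mul continuous_id).tendsto 0
        rw [mul_zero] at this
        exact this.mono_left nhdsWithin_le_nhds
      · filter_upwards [self_mem_nhdsWithin] with ε hε
        exact mul_ne_zero hα hε
    exact ht.eventually (eventually_isUnit_add_smul_one A)

theorem eventually_regularOnArc {X : Type*} [TopologicalSpace X]
    {A E : X → Matrix (Fin n) (Fin n) ℂ} {x : X} (hA : Continuous A) (hE : Continuous E)
    (h : RegularOnArc (A x) (E x) θ₁) : ∀ᶠ y in 𝓝 x, RegularOnArc (A y) (E y) θ₁ :=
  isCompact_Icc.eventually_forall_of_forall_eventually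
    (P := fun y θ => IsUnit (Complex.exp ((θ : ℝ) * Complex.I) • E y - A y)) fun θ hθ =>
      eventually_isUnit (f := fun p : X × ℝ => Complex.exp (p.2 * Complex.I) • E p.1 - A p.1)
        (Continuous.continuousAt (by fun_prop)) (h θ hθ)

/-- The opposite signs of the two perturbations cancel, so `W` does not depend on `ε`. -/
theorem smul_Eeps_add_smul_Aeps (A E : Matrix (Fin n) (Fin n) ℂ) (α β ε : ℂ) :
    α • Eeps E β ε + β • Aeps A α ε = α • E + β • A := by
  rw [Eeps, Aeps]
  module

theorem wrap_of_mem {φ : ℝ} (h : φ ∈ Set.Ioc (-Real.pi) Real.pi) : wrap φ = φ := by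
  rw [wrap, Complex.arg_exp_mul_I, (toIocMod_eq_self Real.two_pi_pos)]
  rwa [show -Real.pi + 2 * Real.pi = Real.pi by ring]

end FreqTrunc

/-! ### Passage to the limit. -/

theorem mainTheorem6 {n : ℕ} (A₀ E₀ : Matrix (Fin n) (Fin n) ℝ)
    (A E W : Matrix (Fin n) (Fin n) ℂ)
    (hA : A = FreqTrunc.toC A₀) (hE : E = FreqTrunc.toC E₀)
    (α β : ℂ) (hW : W = α • E + β • A) (hreg : IsUnit W)
    (θ₁ : ℝ) (hθ₁ : θ₁ ∈ Set.Ioo (-Real.pi) Real.pi)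
    (heig : ∀ φ : ℝ, FreqTrunc.wrap φ ∈ Set.Icc θ₁ Real.pi →
      ¬ FreqTrunc.IsPencilEigenvalue A E (Complex.exp (φ * Complex.I)))
    (Y : Matrix (Fin n) (Fin n) ℂ) (hY : Y = FreqTrunc.Yeps A E α β θ₁ 0) :
    -- the inverse and the logarithm in `Y_ε` exist for all small `ε`, `ε = 0` included
    (∀ᶠ ε in 𝓝 (0 : ℂ), IsUnit (FreqTrunc.phiPlus A E α β ε) ∧
      FreqTrunc.IsPrincipalLog (FreqTrunc.logArg A E α β θ₁ ε)
        (FreqTrunc.principalLog (FreqTrunc.logArg A E α β θ₁ ε))) ∧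
    -- `Y = lim Y_ε`
    Tendsto (fun ε : ℂ => FreqTrunc.Yeps A E α β θ₁ ε) (𝓝[≠] 0) (𝓝 Y) ∧
    -- `L_f = lim (exp Y_ε - I)⁻¹ Y_ε = ψ₁(Y)⁻¹`
    (∀ᶠ ε in 𝓝[≠] (0 : ℂ), IsUnit (NormedSpace.exp (FreqTrunc.Yeps A E α β θ₁ ε) - 1)) ∧
    IsUnit (FreqTrunc.psi1 Y) ∧
    Tendsto (fun ε : ℂ => (NormedSpace.exp (FreqTrunc.Yeps A E α β θ₁ ε) - 1)⁻¹ *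
      FreqTrunc.Yeps A E α β θ₁ ε) (𝓝[≠] 0) (𝓝 (FreqTrunc.psi1 Y)⁻¹) ∧
    -- the integral
    (∀ i k, IntervalIntegrable
      (fun θ : ℝ => FreqTrunc.transfer A E (Complex.exp (θ * Complex.I)) i k)
      MeasureTheory.volume θ₁ Real.pi) ∧
    FreqTrunc.matrixIntegral
        (fun θ : ℝ => FreqTrunc.transfer A E (Complex.exp (θ * Complex.I))) θ₁ Real.pi =
      (1 / Complex.I) • (W⁻¹ * (FreqTrunc.psi1 Y)⁻¹ *
        ((α - β) • NormedSpace.exp Y +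
          (Complex.exp (-(θ₁ * Complex.I)) * α + β) • (1 : Matrix (Fin n) (Fin n) ℂ))) := by
  open FreqTrunc in
  clear hA hE
  subst hW hY
  have hYdef : ∀ ε, Yeps A E α β θ₁ ε = cayleyLog (Aeps A α ε) (Eeps E β ε) θ₁ := fun ε => rfl
  have hlogdef : ∀ ε, logArg A E α β θ₁ ε = cayleyArg (Aeps A α ε) (Eeps E β ε) θ₁ :=
    fun ε => rfl
  have hA0 : Aeps A α 0 = A := by simp [Aeps]
  have hE0 : Eeps E β 0 = E := by simp [Eeps]
  have hcA : Continuous (Aeps A α) := by unfold Aeps; fun_prop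
  have hcE : Continuous (Eeps E β) := by unfold Eeps; fun_prop
  have hR : RegularOnArc A E θ₁ := by
    intro θ hθ
    have h1 := heig θ (by rwa [wrap_of_mem ⟨hθ₁.1.trans_le hθ.1, hθ.2⟩])
    rw [← neg_sub, IsUnit.neg_iff, Matrix.isUnit_iff_isUnit_det, isUnit_iff_ne_zero]
    exact h1
  have hRe : ∀ᶠ ε in 𝓝 (0 : ℂ), RegularOnArc (Aeps A α ε) (Eeps E β ε) θ₁ :=
    eventually_regularOnArc hcA hcE (by rwa [hA0, hE0])
  have hRe' := hRe.filter_mono (nhdsWithin_le_nhds (s := {0}ᶜ))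
  have hAe := eventually_isUnit_Aeps hreg
  have hK : Tendsto (fun ε => arcIntegral (Aeps A α ε) (Eeps E β ε) θ₁) (𝓝[≠] 0)
      (𝓝 (arcIntegral A E θ₁)) := by
    have := (continuousAt_arcIntegral hcA hcE hθ₁ hRe).tendsto
    rw [hA0, hE0] at this
    exact this.mono_left nhdsWithin_le_nhds
  have hY0 : Yeps A E α β θ₁ 0 = cayleyLog A E θ₁ := by rw [hYdef, hA0, hE0]
  -- Writing `Y_ε = -j A_ε ∫ K_ε` reduces continuity of the matrix logarithm to that of a parametric
  -- integral.
  have hYlim : Tendsto (fun ε : ℂ => Yeps A E α β θ₁ ε) (𝓝[≠] 0) (𝓝 (Yeps A E α β θ₁ 0)) := by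
    have hAlim : Tendsto (Aeps A α) (𝓝[≠] 0) (𝓝 A) := by
      have := hcA.tendsto 0
      rw [hA0] at this
      exact this.mono_left nhdsWithin_le_nhds
    have h1 := ((hAlim.mul hK).const_smul Complex.I).neg
    rw [← hR.cayleyLog_eq hθ₁, ← hY0] at h1
    refine h1.congr' ?_
    filter_upwards [hRe'] with ε hε
    rw [hYdef, hε.cayleyLog_eq hθ₁]
  have hunit : ∀ᶠ ε in 𝓝[≠] (0 : ℂ), IsUnit (NormedSpace.exp (Yeps A E α β θ₁ ε) - 1) := by
    filter_upwards [hRe', hAe] with ε h1 h2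
    exact h1.isUnit_exp_cayleyLog_sub_one hθ₁ h2
  have hψ : IsUnit (psi1 (Yeps A E α β θ₁ 0)) := by
    rw [hY0]; exact hR.isUnit_psi1_cayleyLog hθ₁
  have hψlim : Tendsto (fun ε => (psi1 (Yeps A E α β θ₁ ε))⁻¹) (𝓝[≠] 0)
      (𝓝 (psi1 (Yeps A E α β θ₁ 0))⁻¹) :=
    (continuousAt_inv continuous_psi1.continuousAt hψ).tendsto.comp hYlim
  refine ⟨?_, hYlim, hunit, hψ, ?_, fun i k => ?_, ?_⟩
  · filter_upwards [hRe] with ε hε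
    refine ⟨hε.isUnit_add hθ₁, ?_⟩
    rw [hlogdef, hε.principalLog_cayleyArg hθ₁]
    exact hε.isPrincipalLog_cayleyArg hθ₁
  · refine hψlim.congr' ?_
    filter_upwards [hunit] with ε hε
    exact (inv_exp_sub_one_mul_self hε).symm
  · exact (((continuous_apply k).comp (continuous_apply i)).comp_continuousOn
      (hR.continuousOn_transfer hθ₁)).intervalIntegrable
  -- The closed form holds for small `ε ≠ 0`, where `A_ε` is invertible; both sides converge, so
  -- their limits agree.
  · have hexp := (continuous_exp_matrix.tendsto _).comp hYlim
    have h1 := (((tendsto_const_nhds (x := (α • E + β • A)⁻¹)).mul hψlim).mul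
      ((hexp.const_smul (α - β)).add (tendsto_const_nhds
        (x := (Complex.exp (-(θ₁ * Complex.I)) * α + β) •
          (1 : Matrix (Fin n) (Fin n) ℂ))))).const_smul (1 / Complex.I)
    refine tendsto_nhds_unique hK (h1.congr' ?_)
    filter_upwards [hRe', hAe] with ε h2 h3
    have h4 := h2.arcIntegral_eq_of_isUnit hθ₁ h3 (α := α) (β := β)
      (by rwa [smul_Eeps_add_smul_Aeps])
    rw [smul_Eeps_add_smul_Aeps] at h4
    exact h4.symm
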